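/- **Lemma (typical error components are small for the thermal state of quantum locally testable codes).** Let $\mathcal P=\{I,X,Y,Z\}$, and for a Pauli word $P\in\mathcal P^n$ let $\mathrm{wt}(P)$ be the number of its non-identity factors and $\mathrm{supp}(P)$ the set of qubits carrying them. Let $S$ be a finite set (no repetitions) of pairwise commuting signed Pauli words $\pm P$ on $n$ qubits, the checks, generating a stabilizer group $\mathcal G\not\ni -I$, with code space the joint $1$-eigenspace of $\mathcal G$. Let $C[\mathcal G]\subseteq\mathcal P^n$ be the set of Pauli words commuting with $\mathcal G$, and let $|P|=\min_{z\in C[\mathcal G]}\mathrm{wt}(P\cdot z)$ (products up to phase). For $s>0$ the code is a $(q,s)$-stabilizer LTC if every check has weight at most $q$ and, for every $P\in\mathcal P^n$, a uniformly random check $g\in S$ satisfies $\Pr([g,P]\ne 0)\ge s\,|P|/n$. Put $m=|S|$, $H=\sum_{g\in S}(I-g)/2$ and $\lambda=m/n$. The interaction graph $G(H)$ has the $n$ qubits as vertices, two distinct qubits being adjacent if some check acts nontrivially on both. For $\alpha>0$ and a set $X$ of qubits, let $\mathrm{maxconn}_\alpha(X)$ be the maximal size of a set $T$ of qubits that is connected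 in $G(H)$ and satisfies $|T\cap X|\ge\alpha|T|$ (and $0$ if there is none). Let $\tau_0$ be the uniform mixture on the code space, i.e. the normalized projection onto it. There is an absolute constant $n_0$ such that the following holds for all $n\ge n_0$. Let a $(q,s)$-stabilizer LTC on $n$ qubits with $s>0$ be given, whose interaction graph has maximum degree at most $D$, let $\alpha>0$, and let $$\frac{10}{\alpha}\cdot\frac{\ln D}{s}\;\le\;\beta\;\le\;\frac{\lambda}{\ln n}.$$ Let $\mathcal E\in\mathcal P^n$ be a random error that always has minimal weight, $\mathrm{wt}(\mathcal E)=|\mathcal E|$, and for which the random state $\tau=\mathcal E\,\tau_0\,\mathcal E$ is distributed according to the Gibbs state, i.e. $\mathbb E[\mathcal E\,\tau_0\,\mathcal E]=e^{-\beta H/\lambda}/Z$ with $Z=\mathrm{tr}\,e^{-\beta H/\lambda}$. Then $$\Pr\Big(\mathrm{maxconn}_\alpha(\mathrm{supp}(\mathcal E))>\frac{\ln n}{100}\Big)\le n^{-3}.$$ (For $D=0$ the convention $\ln 0=0$ is used, i.e. the lower bound is $\beta\ge 0$.) -/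

import Mathlib

/-! Stabilizer codes, local testability, thermal Gibbs states and `α`-connected components. -/

namespace ThermalLTC

noncomputable section

/-- Single-qubit Pauli operators up to phase, written additively:
`I = (0,0)`, `X = (1,0)`, `Z = (0,1)`, `Y = (1,1)`. -/
abbrev Pauli : Type := ZMod 2 × ZMod 2

/-- The `2 × 2` matrix of a single-qubit Pauli operator. -/
def pauliMatrix (p : Pauli) : Matrix (Fin 2) (Fin 2) ℂ :=
  if p = (0, 0) then 1
  else if p = (1, 0) then !![0, 1; 1, 0]
  else if p = (0, 1) then !![1, 0; 0, -1]
  else !![0, -Complex.I; Complex.I, 0]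

/-- Pauli words `E₁ ⊗ ⋯ ⊗ Eₙ` with `Eᵢ ∈ {I, X, Y, Z}`; the sum of two words is their product
up to phase. -/
abbrev PauliWord (n : ℕ) : Type := Fin n → Pauli

/-- Operators on `n` qubits, in the computational basis `{0,1}ⁿ`. -/
abbrev QubitOp (n : ℕ) : Type := Matrix (Fin n → Fin 2) (Fin n → Fin 2) ℂ

/-- The tensor product operator `E₁ ⊗ ⋯ ⊗ Eₙ` on `(ℂ²)^{⊗ n}`. -/
def wordOp {n : ℕ} (E : PauliWord n) : QubitOp n :=
  Matrix.of fun x y => ∏ i, pauliMatrix (E i) (x i) (y i)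

/-- The qubits on which a Pauli word is not the identity. -/
def supp {n : ℕ} (E : PauliWord n) : Finset (Fin n) :=
  Finset.univ.filter fun i => E i ≠ 0

/-- Hamming weight of a Pauli word. -/
def wt {n : ℕ} (E : PauliWord n) : ℕ := (supp E).card

/-- A Hermitian Pauli operator: a sign together with a Pauli word. -/
abbrev SignedPauli (n : ℕ) : Type := ℤˣ × PauliWord n

/-- The operator of a signed Pauli word. -/
def signedOp {n : ℕ} (g : SignedPauli n) : QubitOp n :=
  (((g.1 : ℤˣ) : ℤ) : ℂ) • wordOp g.2

/-- The stabilizer group generated by a set of checks (the checks are involutions, so the monoid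
that they generate is a group). -/
def stabGroup {n : ℕ} (S : Finset (SignedPauli n)) : Submonoid (QubitOp n) :=
  Submonoid.closure (signedOp '' (S : Set (SignedPauli n)))

/-- The code space: the mutual `1`-eigenspace of the stabilizer group. -/
def codeSpace {n : ℕ} (S : Finset (SignedPauli n)) :
    Submodule ℂ (EuclideanSpace ℂ (Fin n → Fin 2)) :=
  ⨅ g ∈ stabGroup S, Module.End.eigenspace (Matrix.toEuclideanLin g) 1

/-- `S` is the set of check terms of a stabilizer code: the checks commute in pairs, and the
code space is not zero (equivalently, the group generated by `S` does not contain `-1`). -/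
def IsStabilizerCode {n : ℕ} (S : Finset (SignedPauli n)) : Prop :=
  (∀ g ∈ S, ∀ h ∈ S, Commute (signedOp g) (signedOp h)) ∧ codeSpace S ≠ ⊥

/-- The Pauli words in the centralizer of the stabilizer group. -/
def centralizer {n : ℕ} (S : Finset (SignedPauli n)) : Set (PauliWord n) :=
  {z | ∀ g ∈ stabGroup S, Commute g (wordOp z)}

/-- The weight of `P` modulo the centralizer, `min_z wt (P + z)`. -/
def wtMod {n : ℕ} (S : Finset (SignedPauli n)) (P : PauliWord n) : ℕ :=
  sInf ((fun z => wt (P + z)) '' centralizer S)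

/-- An error of minimal weight in its class modulo the centralizer. -/
def IsMinimalError {n : ℕ} (S : Finset (SignedPauli n)) (E : PauliWord n) : Prop :=
  wt E = wtMod S E

open Classical in
/-- The stabilizer code with check set `S` is a `(q, s)`-stabilizer locally testable code:
the checks are `q`-local, and for every Pauli word `P` a uniformly random check fails to commute
with `P` with probability at least `s · |P| / n`. -/
def IsSLTC {n : ℕ} (S : Finset (SignedPauli n)) (q : ℕ) (s : ℝ) : Prop :=
  IsStabilizerCode S ∧
  (∀ g ∈ S, wt g.2 ≤ q) ∧
  ∀ P : PauliWord n,
    ((wtMod S P : ℝ) / n) * s ≤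
      ((S.filter fun g => ¬ Commute (signedOp g) (wordOp P)).card : ℝ) / S.card

/-- The Hamiltonian `H = ∑_g (1 - g) / 2`, summed over the checks. -/
def hamiltonian {n : ℕ} (S : Finset (SignedPauli n)) : QubitOp n :=
  ∑ g ∈ S, (1 / 2 : ℂ) • (1 - signedOp g)

/-- The energy density `λ = m / n` of the Hamiltonian, with `m` the number of checks. -/
def energyDensity {n : ℕ} (S : Finset (SignedPauli n)) : ℝ := (S.card : ℝ) / n

/-- The Gibbs state `e^{-β H / λ} / Z`, `Z = tr e^{-β H / λ}`. -/
def gibbs {n : ℕ} (S : Finset (SignedPauli n)) (β : ℝ) : QubitOp n :=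
  (Matrix.trace (NormedSpace.exp (((-(β / energyDensity S) : ℝ) : ℂ) • hamiltonian S)))⁻¹ •
    NormedSpace.exp (((-(β / energyDensity S) : ℝ) : ℂ) • hamiltonian S)

/-- The orthogonal projection onto the code space, as a matrix. -/
def codeProj {n : ℕ} (S : Finset (SignedPauli n)) : QubitOp n :=
  (Matrix.toEuclideanCLM (n := Fin n → Fin 2) (𝕜 := ℂ)).symm (codeSpace S).starProjection

/-- The uniform mixture `τ₀` on the code space. -/
def codeState {n : ℕ} (S : Finset (SignedPauli n)) : QubitOp n :=
  (Matrix.trace (codeProj S))⁻¹ • codeProj S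

/-- `μ` is the law of a random error `E` of minimal weight such that the random state
`τ = E τ₀ E` is distributed according to the Gibbs state, that is, the mixture of the states
`E τ₀ E` is `e^{-β H / λ} / Z`. (States `E τ₀ E` that are different are orthogonal, so that this
fixes the law of `τ`; only the choice between errors of minimal weight that give the same
state `τ` is left free.) -/
def IsGibbsErrorLaw {n : ℕ} (S : Finset (SignedPauli n)) (β : ℝ) (μ : PMF (PauliWord n)) : Prop :=
  (∀ E ∈ μ.support, IsMinimalError S E) ∧
  ∑ E : PauliWord n, (((μ E).toReal : ℝ) : ℂ) • (wordOp E * codeState S * wordOp E) = gibbs S β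

/-- The interaction graph: two different qubits are adjacent if some check acts on both. -/
def interactionGraph {n : ℕ} (S : Finset (SignedPauli n)) : SimpleGraph (Fin n) where
  Adj i j := i ≠ j ∧ ∃ g ∈ S, i ∈ supp g.2 ∧ j ∈ supp g.2
  symm := ⟨fun _ _ h => ⟨h.1.symm, h.2.imp fun _ hg => ⟨hg.1, hg.2.2, hg.2.1⟩⟩⟩
  loopless := ⟨fun _ h => h.1 rfl⟩

/-- `T` is an `α`-subset of `X`: `|T ∩ X| ≥ α |T|`. -/
def IsAlphaSubset {V : Type*} [DecidableEq V] (α : ℝ) (X T : Finset V) : Prop :=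
  α * (T.card : ℝ) ≤ ((T ∩ X).card : ℝ)

open Classical in
/-- The maximal size of a connected `α`-subset of `X` (`0` if there is none). -/
def maxconn {V : Type*} [Fintype V] [DecidableEq V] (G : SimpleGraph V) (α : ℝ)
    (X : Finset V) : ℕ :=
  (Finset.univ.filter fun T : Finset V =>
    (G.induce (T : Set V)).Connected ∧ IsAlphaSubset α X T).sup Finset.card

end

end ThermalLTC

/-! The Gibbs condition determines the law of the syndrome (the set of violated checks), though not
the law of the error itself. Testing both sides of the mixture identity against `E Π E`, with `Π`
the code projection, shows that a syndrome occurs with probability proportional to `e^{-(β/λ)k}`,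
where `k` is its number of violated checks (`sum_law_eq_of_gibbs`, `syndromeProb_eq_exp_mul`).

The rest is a Peierls argument. For a bad error `E`, a largest connected `α`-subset `T` of its
support has no neighbour in the remaining support (`exists_isolated_alphaSubset`). So the parts of
`E` inside and outside `T` violate disjoint sets of checks, and erasing the inner part lowers the
energy by that part's own energy. The inner part still has minimal weight, so local testability
makes this energy at least `s λ α |T|`. By the lower bound on `β`, the probability is then at most
`D^{-10|T|}` times that of the erased syndrome (`syndromeProb_le_of_isolated`).

For a fixed word on `T` the erasure is an injective shift of syndromes, so a union bound over pairs
(set, word) applies. There are at most `4^t` words on a set of size `t`, and at most `D^{2t}`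
connected sets of size `t` through a given vertex. The total is at most `n²` times the largest `(4
D^{-8})^t` with `t > ln n / 100`, which gives `n^{-3}` once `D ≥ 2^100`.

Large degree is automatic if a bad error exists. The two bounds on `β` force `ln n ≤ s λ`, while `s
λ` is at most the number of distinct checks at one qubit, hence at most `2 · 4^{D+1}`. -/

namespace ThermalLTC

open scoped ComplexOrder Matrix

/-! ### Pauli words and their commutation signs -/

/-- The sign `ε` with `p q = ε q p` for single-qubit Pauli operators. -/
def pauliSign (p q : Pauli) : ℤˣ := if p.1 * q.2 + p.2 * q.1 = 0 then 1 else -1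

theorem pauliSign_zero_left (q : Pauli) : pauliSign 0 q = 1 := by revert q; decide

theorem pauliSign_zero_right (p : Pauli) : pauliSign p 0 = 1 := by revert p; decide

theorem pauliSign_add (p q r : Pauli) : pauliSign p (q + r) = pauliSign p q * pauliSign p r := by
  revert p q r; decide

theorem pauli_cases (p : Pauli) : p = (0, 0) ∨ p = (1, 0) ∨ p = (0, 1) ∨ p = (1, 1) := by
  revert p; decide

theorem pauliMatrix_I : pauliMatrix (0, 0) = 1 := by simp [pauliMatrix]

theorem pauliMatrix_X : pauliMatrix (1, 0) = !![0, 1; 1, 0] := by simp [pauliMatrix]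

theorem pauliMatrix_Z : pauliMatrix (0, 1) = !![1, 0; 0, -1] := by simp [pauliMatrix]

theorem pauliMatrix_Y : pauliMatrix (1, 1) = !![0, -Complex.I; Complex.I, 0] := by
  simp [pauliMatrix]

theorem pauliMatrix_mul_comm (p q : Pauli) :
    pauliMatrix p * pauliMatrix q =
      (((pauliSign p q : ℤˣ) : ℤ) : ℂ) • (pauliMatrix q * pauliMatrix p) := by
  rcases pauli_cases p with rfl | rfl | rfl | rfl <;>
  rcases pauli_cases q with rfl | rfl | rfl | rfl <;>
  simp [pauliMatrix_I, pauliMatrix_X, pauliMatrix_Y, pauliMatrix_Z, pauliSign,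
    CharTwo.add_self_eq_zero]

theorem pauliMatrix_mul_self (p : Pauli) : pauliMatrix p * pauliMatrix p = 1 := by
  rcases pauli_cases p with rfl | rfl | rfl | rfl <;>
  simp [pauliMatrix_I, pauliMatrix_X, pauliMatrix_Y, pauliMatrix_Z, Matrix.one_fin_two]

theorem pauliMatrix_conjTranspose (p : Pauli) : (pauliMatrix p)ᴴ = pauliMatrix p := by
  rcases pauli_cases p with rfl | rfl | rfl | rfl <;> ext i j <;> fin_cases i <;> fin_cases j <;>
  simp [pauliMatrix_I, pauliMatrix_X, pauliMatrix_Y, pauliMatrix_Z]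

/-- The tensor product of single-qubit operators. -/
def tensorOp {n : ℕ} (M : Fin n → Matrix (Fin 2) (Fin 2) ℂ) : QubitOp n :=
  Matrix.of fun x y => ∏ i, M i (x i) (y i)

theorem wordOp_eq_tensorOp {n : ℕ} (E : PauliWord n) :
    wordOp E = tensorOp fun i => pauliMatrix (E i) := rfl

theorem tensorOp_mul {n : ℕ} (M N : Fin n → Matrix (Fin 2) (Fin 2) ℂ) :
    tensorOp M * tensorOp N = tensorOp fun i => M i * N i := by
  ext x z
  simp only [tensorOp, Matrix.mul_apply, Matrix.of_apply]
  rw [Finset.prod_univ_sum, Fintype.piFinset_univ]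
  simp [Finset.prod_mul_distrib]

theorem tensorOp_one {n : ℕ} : tensorOp (fun _ : Fin n => 1) = 1 := by
  ext x y
  simp only [tensorOp, Matrix.of_apply, Matrix.one_apply]
  by_cases h : x = y
  · subst h; simp
  · obtain ⟨i, hi⟩ := Function.ne_iff.mp h
    rw [if_neg h]
    exact Finset.prod_eq_zero (Finset.mem_univ i) (by simp [hi])

theorem tensorOp_smul {n : ℕ} (c : Fin n → ℂ) (M : Fin n → Matrix (Fin 2) (Fin 2) ℂ) :
    tensorOp (fun i => c i • M i) = (∏ i, c i) • tensorOp M := by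
  ext x y
  simp [tensorOp, Finset.prod_mul_distrib]

theorem wordOp_mul_self {n : ℕ} (E : PauliWord n) : wordOp E * wordOp E = 1 := by
  simp only [wordOp_eq_tensorOp, tensorOp_mul, pauliMatrix_mul_self, tensorOp_one]

theorem wordOp_conjTranspose {n : ℕ} (E : PauliWord n) : (wordOp E)ᴴ = wordOp E := by
  ext x y
  simp only [wordOp, Matrix.conjTranspose_apply, Matrix.of_apply, star_prod]
  refine Finset.prod_congr rfl fun i _ => ?_
  conv_rhs => rw [← pauliMatrix_conjTranspose, Matrix.conjTranspose_apply]

/-- The sign `ε` with `E F = ε F E` for Pauli words. -/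
def wordSign {n : ℕ} (E F : PauliWord n) : ℤˣ := ∏ i, pauliSign (E i) (F i)

theorem wordSign_add {n : ℕ} (E F G : PauliWord n) :
    wordSign E (F + G) = wordSign E F * wordSign E G := by
  simp [wordSign, pauliSign_add, Finset.prod_mul_distrib]

theorem wordSign_eq_one_of_disjoint {n : ℕ} {E F : PauliWord n}
    (h : Disjoint (supp E) (supp F)) : wordSign E F = 1 := by
  refine Finset.prod_eq_one fun i _ => ?_
  by_cases hE : E i = 0
  · rw [hE, pauliSign_zero_left]
  · have hF : F i = 0 := by
      by_contra hF
      exact Finset.disjoint_left.mp h (show i ∈ supp E by simp [supp, hE]) (show i ∈ supp F by simp [supp, hF])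
    rw [hF, pauliSign_zero_right]

theorem wordOp_mul_comm {n : ℕ} (E F : PauliWord n) :
    wordOp E * wordOp F = (((wordSign E F : ℤˣ) : ℤ) : ℂ) • (wordOp F * wordOp E) := by
  simp only [wordOp_eq_tensorOp, tensorOp_mul]
  simp only [fun i => pauliMatrix_mul_comm (E i) (F i), tensorOp_smul, wordSign]
  simp

theorem signedOp_mul_wordOp {n : ℕ} (g : SignedPauli n) (E : PauliWord n) :
    signedOp g * wordOp E =
      (((wordSign g.2 E : ℤˣ) : ℤ) : ℂ) • (wordOp E * signedOp g) := by
  rw [signedOp, smul_mul_assoc, wordOp_mul_comm, mul_smul_comm, smul_comm]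

theorem signedOp_conjTranspose {n : ℕ} (g : SignedPauli n) : (signedOp g)ᴴ = signedOp g := by
  simp [signedOp, Matrix.conjTranspose_smul, wordOp_conjTranspose]

theorem unit_sq_complex (u : ℤˣ) : (((u : ℤˣ) : ℤ) : ℂ) * (((u : ℤˣ) : ℤ) : ℂ) = 1 := by
  rcases Int.units_eq_one_or u with rfl | rfl <;> simp

theorem signedOp_mul_self {n : ℕ} (g : SignedPauli n) : signedOp g * signedOp g = 1 := by
  rw [signedOp, smul_mul_smul_comm, wordOp_mul_self, unit_sq_complex, one_smul]

theorem commute_signedOp_wordOp_iff {n : ℕ} (g : SignedPauli n) (E : PauliWord n) :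
    Commute (signedOp g) (wordOp E) ↔ wordSign g.2 E = 1 := by
  constructor
  · intro h
    by_contra hne
    have hneg : wordSign g.2 E = -1 := (Int.units_eq_one_or _).resolve_left hne
    have h1 := signedOp_mul_wordOp g E
    rw [← h.eq, hneg] at h1
    have h0 : signedOp g * wordOp E = 0 := by
      have : signedOp g * wordOp E = -(signedOp g * wordOp E) := by simpa using h1
      have h2 : (2 : ℂ) • (signedOp g * wordOp E) = 0 := by
        rw [two_smul]; nth_rewrite 1 [this]; simp
      exact (smul_eq_zero.mp h2).resolve_left two_ne_zero
    have : (1 : QubitOp n) = 0 := by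
      calc (1 : QubitOp n) = signedOp g * (signedOp g * wordOp E) * wordOp E := by
            rw [← mul_assoc, signedOp_mul_self, one_mul, wordOp_mul_self]
        _ = 0 := by rw [h0]; simp
    exact one_ne_zero this
  · intro h
    have h1 := signedOp_mul_wordOp g E
    rw [h] at h1
    rw [commute_iff_eq]
    simpa using h1

theorem mem_centralizer_iff {n : ℕ} (S : Finset (SignedPauli n)) (z : PauliWord n) :
    z ∈ centralizer S ↔ ∀ g ∈ S, wordSign g.2 z = 1 := by
  constructor
  · intro h g hg
    exact (commute_signedOp_wordOp_iff g z).mp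
      (h _ (Submonoid.subset_closure ⟨g, hg, rfl⟩))
  · intro h g hg
    induction hg using Submonoid.closure_induction with
    | mem x hx =>
      obtain ⟨g, hg, rfl⟩ := hx
      exact (commute_signedOp_wordOp_iff g z).mpr (h g hg)
    | one => exact Commute.one_left _
    | mul x y _ _ hx hy => exact hx.mul_left hy

/-! ### The projection onto the code space -/

theorem mem_codeSpace_iff {n : ℕ} (S : Finset (SignedPauli n))
    (x : EuclideanSpace ℂ (Fin n → Fin 2)) :
    x ∈ codeSpace S ↔ ∀ g ∈ S, Matrix.toEuclideanLin (signedOp g) x = x := by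
  simp only [codeSpace, Submodule.mem_iInf, Module.End.mem_eigenspace_iff, one_smul]
  constructor
  · intro h g hg
    exact h _ (Submonoid.subset_closure ⟨g, hg, rfl⟩)
  · intro h g hg
    induction hg using Submonoid.closure_induction with
    | mem y hy =>
      obtain ⟨g, hg, rfl⟩ := hy
      exact h g hg
    | one => simp [Matrix.toLpLin_one]
    | mul a b _ _ ha hb =>
      rw [Matrix.toLpLin_mul_same, LinearMap.comp_apply, hb, ha]

theorem toEuclideanLin_codeProj {n : ℕ} (S : Finset (SignedPauli n))
    (x : EuclideanSpace ℂ (Fin n → Fin 2)) :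
    Matrix.toEuclideanLin (codeProj S) x = (codeSpace S).starProjection x := by
  have h : Matrix.toEuclideanCLM (n := Fin n → Fin 2) (𝕜 := ℂ) (codeProj S) =
      (codeSpace S).starProjection := by simp [codeProj]
  rw [← h]; rfl

theorem codeProj_mul_self {n : ℕ} (S : Finset (SignedPauli n)) :
    codeProj S * codeProj S = codeProj S := by
  rw [codeProj, ← map_mul]
  congr 1
  exact Submodule.isIdempotentElem_starProjection _

theorem codeProj_conjTranspose {n : ℕ} (S : Finset (SignedPauli n)) :
    (codeProj S)ᴴ = codeProj S := by
  rw [codeProj, ← Matrix.star_eq_conjTranspose]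
  refine ((Matrix.toEuclideanCLM (n := Fin n → Fin 2) (𝕜 := ℂ)).symm.map_star' _).symm.trans (congrArg _ ?_)
  exact (isSelfAdjoint_starProjection _).star_eq

theorem signedOp_mul_codeProj {n : ℕ} {S : Finset (SignedPauli n)} {g : SignedPauli n}
    (hg : g ∈ S) : signedOp g * codeProj S = codeProj S := by
  apply (Matrix.toEuclideanLin (𝕜 := ℂ)).injective
  ext1 x
  rw [Matrix.toLpLin_mul_same, LinearMap.comp_apply]
  refine (mem_codeSpace_iff S _).mp ?_ g hg
  rw [toEuclideanLin_codeProj]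
  exact Submodule.starProjection_apply_mem _ _

theorem codeProj_mul_signedOp {n : ℕ} {S : Finset (SignedPauli n)} {g : SignedPauli n}
    (hg : g ∈ S) : codeProj S * signedOp g = codeProj S := by
  have h := congrArg Matrix.conjTranspose (signedOp_mul_codeProj hg)
  rwa [Matrix.conjTranspose_mul, codeProj_conjTranspose, signedOp_conjTranspose] at h

/-- An operator commuting with all checks maps the code space into itself, so the outer projection
has no effect. -/
theorem codeProj_mul_mul_codeProj {n : ℕ} {S : Finset (SignedPauli n)} {W : QubitOp n}
    (hW : ∀ g ∈ S, Commute (signedOp g) W) :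
    codeProj S * W * codeProj S = W * codeProj S := by
  apply (Matrix.toEuclideanLin (𝕜 := ℂ)).injective
  ext1 x
  rw [mul_assoc, Matrix.toLpLin_mul_same, LinearMap.comp_apply, toEuclideanLin_codeProj]
  refine Submodule.starProjection_eq_self_iff.mpr ?_
  rw [mem_codeSpace_iff]
  intro g hg
  rw [← LinearMap.comp_apply, ← Matrix.toLpLin_mul_same, ← mul_assoc, (hW g hg).eq, mul_assoc,
    signedOp_mul_codeProj hg]

theorem trace_codeProj_ne_zero {n : ℕ} {S : Finset (SignedPauli n)} (hS : codeSpace S ≠ ⊥) :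
    Matrix.trace (codeProj S) ≠ 0 := by
  intro h
  rw [← codeProj_mul_self] at h
  nth_rewrite 1 [← codeProj_conjTranspose] at h
  rw [Matrix.trace_conjTranspose_mul_self_eq_zero_iff] at h
  apply hS
  rw [eq_bot_iff]
  intro x hx
  have h1 := toEuclideanLin_codeProj S x
  rw [h, Submodule.starProjection_eq_self_iff.mpr hx] at h1
  simpa using h1.symm

/-! ### Syndromes and their Gibbs probabilities -/

/-- The checks that are violated by a Pauli word. -/
def syndrome {n : ℕ} (S : Finset (SignedPauli n)) (E : PauliWord n) : Finset (SignedPauli n) :=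
  S.filter fun g => wordSign g.2 E ≠ 1

theorem wordSign_eq_of_syndrome_eq {n : ℕ} {S : Finset (SignedPauli n)} {E F : PauliWord n}
    (h : syndrome S E = syndrome S F) {g : SignedPauli n} (hg : g ∈ S) :
    wordSign g.2 E = wordSign g.2 F := by
  have h1 : g ∈ syndrome S E ↔ g ∈ syndrome S F := by rw [h]
  simp only [syndrome, Finset.mem_filter, hg, true_and, ne_eq, not_iff_not] at h1
  rcases Int.units_eq_one_or (wordSign g.2 E) with hE | hE <;>
  rcases Int.units_eq_one_or (wordSign g.2 F) with hF | hF <;> simp_all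

theorem signedOp_mul_wordOp_mul_wordOp {n : ℕ} (g : SignedPauli n) (E F : PauliWord n) :
    signedOp g * (wordOp E * wordOp F) =
      (((wordSign g.2 E * wordSign g.2 F : ℤˣ) : ℤ) : ℂ) •
        (wordOp E * wordOp F * signedOp g) := by
  rw [← mul_assoc, signedOp_mul_wordOp, smul_mul_assoc, mul_assoc, signedOp_mul_wordOp,
    mul_smul_comm, smul_smul, mul_assoc]
  simp

/-- With equal syndromes `F E` commutes with every check, so both projections have the same range.
Otherwise some check `g` separates the syndromes; absorbing `g` into the left copy of `Π` and moving
it across `F E` gives `Π F E Π = -Π F E Π`, so the ranges are orthogonal. -/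
theorem trace_conj_codeProj_mul {n : ℕ} (S : Finset (SignedPauli n)) (E F : PauliWord n) :
    Matrix.trace ((wordOp F * codeProj S * wordOp F) * (wordOp E * codeProj S * wordOp E)) =
      if syndrome S F = syndrome S E then Matrix.trace (codeProj S) else 0 := by
  have h1 : (wordOp F * codeProj S * wordOp F) * (wordOp E * codeProj S * wordOp E) =
      wordOp F * (codeProj S * (wordOp F * wordOp E) * codeProj S * wordOp E) := by
    simp only [mul_assoc]
  rw [h1, Matrix.trace_mul_comm]
  split_ifs with h
  · rw [codeProj_mul_mul_codeProj]
    · have h2 : wordOp F * wordOp E * codeProj S * wordOp E * wordOp F =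
          wordOp F * (wordOp E * codeProj S * wordOp E * wordOp F) := by simp only [mul_assoc]
      rw [h2, Matrix.trace_mul_comm]
      have h3 : wordOp E * codeProj S * wordOp E * wordOp F * wordOp F =
          wordOp E * (codeProj S * wordOp E) := by
        rw [mul_assoc _ (wordOp F), wordOp_mul_self, mul_one, mul_assoc]
      rw [h3, Matrix.trace_mul_comm, mul_assoc, wordOp_mul_self, mul_one]
    · intro g hg
      rw [commute_iff_eq, signedOp_mul_wordOp_mul_wordOp, wordSign_eq_of_syndrome_eq h hg]
      simp
  · obtain ⟨g, hg, hne⟩ : ∃ g ∈ S, wordSign g.2 F ≠ wordSign g.2 E := by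
      by_contra! hcon
      exact h (Finset.filter_congr fun g hg => by rw [hcon g hg])
    have hneg : wordSign g.2 F * wordSign g.2 E = -1 := by
      rcases Int.units_eq_one_or (wordSign g.2 E) with hE | hE <;>
      rcases Int.units_eq_one_or (wordSign g.2 F) with hF | hF <;> simp_all
    have h0 : codeProj S * (wordOp F * wordOp E) * codeProj S =
        -(codeProj S * (wordOp F * wordOp E) * codeProj S) := by
      calc codeProj S * (wordOp F * wordOp E) * codeProj S
          = codeProj S * (signedOp g * (wordOp F * wordOp E)) * codeProj S := by
            rw [← mul_assoc (codeProj S) (signedOp g), codeProj_mul_signedOp hg]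
        _ = -(codeProj S * (wordOp F * wordOp E) * (signedOp g * codeProj S)) := by
            rw [signedOp_mul_wordOp_mul_wordOp, hneg]
            simp [mul_assoc]
        _ = _ := by rw [signedOp_mul_codeProj hg]
    have h2 : (2 : ℂ) • (codeProj S * (wordOp F * wordOp E) * codeProj S) = 0 := by
      rw [two_smul]; nth_rewrite 1 [h0]; simp
    rw [(smul_eq_zero.mp h2).resolve_left two_ne_zero]
    simp

theorem hamiltonian_mul_wordOp_mul_codeProj {n : ℕ} (S : Finset (SignedPauli n))
    (E : PauliWord n) :
    hamiltonian S * (wordOp E * codeProj S) =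
      ((syndrome S E).card : ℂ) • (wordOp E * codeProj S) := by
  have h : ∀ g ∈ S, (1 / 2 : ℂ) • (1 - signedOp g) * (wordOp E * codeProj S) =
      (if wordSign g.2 E ≠ 1 then (1 : ℂ) else 0) • (wordOp E * codeProj S) := by
    intro g hg
    rw [smul_mul_assoc, sub_mul, one_mul, ← mul_assoc, signedOp_mul_wordOp, smul_mul_assoc,
      mul_assoc, signedOp_mul_codeProj hg]
    rcases Int.units_eq_one_or (wordSign g.2 E) with hE | hE
    · simp [hE]
    · have : (-1 : ℤˣ) ≠ 1 := by decide
      simp only [hE, ne_eq, this, not_false_eq_true, if_true, one_smul]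
      simp [smul_smul, ← two_smul ℂ]
  rw [hamiltonian, Finset.sum_mul, Finset.sum_congr rfl h, ← Finset.sum_smul, Finset.sum_boole]
  rfl

section exp

attribute [local instance] Matrix.linftyOpNormedRing Matrix.linftyOpNormedAlgebra

theorem exp_mul_eq_of_mul_eq_smul {m : Type*} [Fintype m] [DecidableEq m] {A M : Matrix m m ℂ}
    {c : ℂ} (h : A * M = c • M) : NormedSpace.exp A * M = Complex.exp c • M := by
  have h1 : ∀ k : ℕ, A ^ k * M = c ^ k • M := by
    intro k
    induction k with
    | zero => simp
    | succ k ih => rw [pow_succ, mul_assoc, h, mul_smul_comm, ih, smul_smul, pow_succ']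
  have h2 := (NormedSpace.exp_series_hasSum_exp' (𝕂 := ℂ) A).mul_right M
  have h3 := (NormedSpace.exp_series_hasSum_exp' (𝕂 := ℂ) c).smul_const M
  rw [← Complex.exp_eq_exp_ℂ] at h3
  have h4 : ∀ k : ℕ, ((k.factorial : ℂ)⁻¹ • A ^ k) * M = ((k.factorial : ℂ)⁻¹ • c ^ k) • M := by
    intro k
    rw [smul_mul_assoc, h1, smul_smul, smul_eq_mul]
  simp only [h4] at h2
  exact h2.unique h3

end exp

/-- Both sides of the mixture identity are multiplied by `E Π E` and traced. On the left,
orthogonality keeps only the errors with the syndrome of `E`; on the right, the range of `E Π` is an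
eigenspace of the Hamiltonian. -/
theorem sum_law_eq_of_gibbs {n : ℕ} {S : Finset (SignedPauli n)} (hS : codeSpace S ≠ ⊥) {β : ℝ}
    {μ : PMF (PauliWord n)} (hμ : IsGibbsErrorLaw S β μ) (E : PauliWord n) :
    ((∑ F : PauliWord n, if syndrome S F = syndrome S E then (μ F).toReal else 0 : ℝ) : ℂ) =
      (Matrix.trace (NormedSpace.exp (((-(β / energyDensity S) : ℝ) : ℂ) • hamiltonian S)))⁻¹ *
        Matrix.trace (codeProj S) *
        (Real.exp (-(β / energyDensity S) * (syndrome S E).card) : ℂ) := by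
  have hd := trace_codeProj_ne_zero hS
  have h := congrArg (fun M => Matrix.trace (M * (wordOp E * codeProj S * wordOp E))) hμ.2
  simp only [Finset.sum_mul, Matrix.trace_sum] at h
  have h1 : ∀ F : PauliWord n, Matrix.trace ((((μ F).toReal : ℝ) : ℂ) •
      (wordOp F * codeState S * wordOp F) * (wordOp E * codeProj S * wordOp E)) =
      ((if syndrome S F = syndrome S E then (μ F).toReal else 0 : ℝ) : ℂ) := by
    intro F
    rw [codeState, mul_smul_comm, smul_mul_assoc, smul_mul_assoc, smul_mul_assoc,
      Matrix.trace_smul, Matrix.trace_smul, trace_conj_codeProj_mul]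
    split_ifs <;> simp [hd]
  rw [Finset.sum_congr rfl fun F _ => h1 F] at h
  rw [Complex.ofReal_sum, h, gibbs, smul_mul_assoc, Matrix.trace_smul, ← mul_assoc,
    exp_mul_eq_of_mul_eq_smul
      (c := ((-(β / energyDensity S) : ℝ) : ℂ) * ((syndrome S E).card : ℂ))
      (by rw [smul_mul_assoc, hamiltonian_mul_wordOp_mul_codeProj, smul_smul]),
    smul_mul_assoc, Matrix.trace_smul, Matrix.trace_mul_comm (wordOp E * codeProj S), ← mul_assoc,
    wordOp_mul_self, one_mul]
  simp only [smul_eq_mul]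
  push_cast
  ring

/-- The probability that a random error has the syndrome `c`. -/
noncomputable def syndromeProb {n : ℕ} (S : Finset (SignedPauli n)) (μ : PMF (PauliWord n))
    (c : Finset (SignedPauli n)) : ℝ :=
  ∑ F : PauliWord n, if syndrome S F = c then (μ F).toReal else 0

/-- Ratios of syndrome probabilities are given by the Boltzmann weights. -/
theorem syndromeProb_eq_exp_mul {n : ℕ} {S : Finset (SignedPauli n)} (hS : codeSpace S ≠ ⊥)
    {β : ℝ} {μ : PMF (PauliWord n)} (hμ : IsGibbsErrorLaw S β μ) (E F : PauliWord n) {k : ℕ}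
    (hk : (syndrome S E).card = (syndrome S F).card + k) :
    syndromeProb S μ (syndrome S E) =
      Real.exp (-(β / energyDensity S) * k) * syndromeProb S μ (syndrome S F) := by
  have hE := sum_law_eq_of_gibbs hS hμ E
  have hF := sum_law_eq_of_gibbs hS hμ F
  apply Complex.ofReal_injective
  rw [syndromeProb, syndromeProb, hE, Complex.ofReal_mul, hF, hk]
  push_cast
  rw [mul_add, Complex.exp_add]
  ring

theorem syndromeProb_nonneg {n : ℕ} (S : Finset (SignedPauli n)) (μ : PMF (PauliWord n))
    (c : Finset (SignedPauli n)) : 0 ≤ syndromeProb S μ c :=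
  Finset.sum_nonneg fun F _ => by split_ifs <;> simp

theorem sum_toReal_eq_one {n : ℕ} (μ : PMF (PauliWord n)) : ∑ F, (μ F).toReal = 1 := by
  rw [← ENNReal.toReal_sum fun F _ => μ.apply_ne_top F, ← tsum_fintype (L := .unconditional _),
    μ.tsum_coe, ENNReal.toReal_one]

theorem sum_syndromeProb_le_one {n : ℕ} (S : Finset (SignedPauli n)) (μ : PMF (PauliWord n))
    (C : Finset (Finset (SignedPauli n))) : ∑ c ∈ C, syndromeProb S μ c ≤ 1 := by
  simp only [syndromeProb]
  rw [Finset.sum_comm, ← sum_toReal_eq_one μ]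
  refine Finset.sum_le_sum fun F _ => ?_
  rw [Finset.sum_ite_eq]
  split_ifs <;> simp


/-! ### Counting connected vertex sets by walks -/

open Classical in
/-- The vertex sets of the walks with `ℓ` steps that start at `v`. -/
noncomputable def walkRanges {V : Type*} [Fintype V] [DecidableEq V]
    (G : SimpleGraph V) : ℕ → V → Finset (Finset V)
  | 0, v => {{v}}
  | ℓ + 1, v => (Finset.univ.filter fun u => G.Adj v u).biUnion fun u =>
      (walkRanges G ℓ u).image fun U => insert v U

theorem card_walkRanges_le {V : Type*} [Fintype V] [DecidableEq V]
    {G : SimpleGraph V} {D : ℕ}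
    (hD : ∀ v, (G.neighborSet v).ncard ≤ D) (ℓ : ℕ) (v : V) :
    (walkRanges G ℓ v).card ≤ D ^ ℓ := by
  classical
  induction ℓ generalizing v with
  | zero => simp [walkRanges]
  | succ ℓ ih =>
    rw [walkRanges, pow_succ']
    refine (Finset.card_biUnion_le_card_mul _ _ (D ^ ℓ) fun u _ =>
      Finset.card_image_le.trans (ih u)).trans ?_
    refine Nat.mul_le_mul_right _ ((le_of_eq ?_).trans (hD v))
    rw [← Set.ncard_coe_finset]
    congr 1
    ext u
    simp

theorem mem_of_mem_walkRanges {V : Type*} [Fintype V] [DecidableEq V]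
    {G : SimpleGraph V} {ℓ : ℕ} {v : V} {U : Finset V}
    (hU : U ∈ walkRanges G ℓ v) : v ∈ U := by
  cases ℓ with
  | zero => simp_all [walkRanges]
  | succ ℓ =>
    simp only [walkRanges, Finset.mem_biUnion, Finset.mem_image] at hU
    obtain ⟨_, _, _, _, rfl⟩ := hU
    simp

/-- When the walk visits `u`, the detour `u → w → u` adds `w` at the cost of two steps. -/
theorem insert_mem_walkRanges {V : Type*} [Fintype V] [DecidableEq V]
    {G : SimpleGraph V} {ℓ : ℕ} {v u w : V} {U : Finset V}
    (hU : U ∈ walkRanges G ℓ v) (hu : u ∈ U) (huw : G.Adj u w) :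
    insert w U ∈ walkRanges G (ℓ + 2) v := by
  have detour : ∀ {ℓ : ℕ} {v : V} {U : Finset V}, U ∈ walkRanges G ℓ v → G.Adj v w →
      insert w U ∈ walkRanges G (ℓ + 2) v := by
    intro ℓ v U hU hvw
    simp only [walkRanges, Finset.mem_biUnion, Finset.mem_image, Finset.mem_filter,
      Finset.mem_univ, true_and]
    refine ⟨w, hvw, insert w U, ⟨v, hvw.symm, U, hU, rfl⟩, ?_⟩
    exact Finset.insert_eq_of_mem (Finset.mem_insert_of_mem (mem_of_mem_walkRanges hU))
  induction ℓ generalizing v U with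
  | zero =>
    have hU' := hU
    rw [walkRanges, Finset.mem_singleton] at hU'
    rw [hU', Finset.mem_singleton] at hu
    subst hu
    exact detour hU huw
  | succ ℓ ih =>
    by_cases huv : u = v
    · subst huv
      exact detour hU huw
    · rw [walkRanges, Finset.mem_biUnion] at hU
      obtain ⟨x, hx, hU⟩ := hU
      rw [Finset.mem_image] at hU
      obtain ⟨U', hU', rfl⟩ := hU
      have hu' : u ∈ U' := (Finset.mem_insert.mp hu).resolve_left huv
      rw [walkRanges, Finset.mem_biUnion]
      refine ⟨x, hx, ?_⟩
      rw [Finset.mem_image]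
      exact ⟨insert w U', ih hU' hu', Finset.insert_comm _ _ _⟩

theorem exists_adj_of_connected_induce {V : Type*} {G : SimpleGraph V} {T U : Finset V}
    (hT : (G.induce (T : Set V)).Connected) {v x : V} (hvU : v ∈ U) (hvT : v ∈ T) (hxT : x ∈ T)
    (hxU : x ∉ U) : ∃ u ∈ U, u ∈ T ∧ ∃ w ∈ T, w ∉ U ∧ G.Adj u w := by
  obtain ⟨p⟩ := hT.preconnected ⟨v, hvT⟩ ⟨x, hxT⟩
  obtain ⟨d, -, h1, h2⟩ := p.exists_boundary_dart {y | (y : V) ∈ U} hvU hxU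
  exact ⟨d.fst, h1, d.fst.2, d.snd, d.snd.2, h2, d.adj⟩

/-- Starting from `{v}`, connectedness always supplies an edge leaving the part of `T` collected so
far, and each of the `|T| - 1` further vertices costs one detour. -/
theorem mem_walkRanges_of_connected {V : Type*} [Fintype V] [DecidableEq V]
    {G : SimpleGraph V} {T : Finset V}
    (hT : (G.induce (T : Set V)).Connected) {v : V} (hv : v ∈ T) :
    T ∈ walkRanges G (2 * (T.card - 1)) v := by
  have key : ∀ k : ℕ, k + 1 ≤ T.card →
      ∃ U ⊆ T, U.card = k + 1 ∧ U ∈ walkRanges G (2 * k) v := by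
    intro k
    induction k with
    | zero => exact fun _ => ⟨{v}, by simpa using hv, by simp, by simp [walkRanges]⟩
    | succ k ih =>
      intro hk
      obtain ⟨U, hUT, hUc, hU⟩ := ih (by omega)
      obtain ⟨x, hxT, hxU⟩ := Finset.exists_mem_notMem_of_card_lt_card (s := U) (t := T) (by omega)
      obtain ⟨u, huU, -, w, hwT, hwU, huw⟩ :=
        exists_adj_of_connected_induce hT (mem_of_mem_walkRanges hU) hv hxT hxU
      exact ⟨insert w U, Finset.insert_subset hwT hUT,
        by rw [Finset.card_insert_of_notMem hwU, hUc], insert_mem_walkRanges hU huU huw⟩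
  have hpos : 0 < T.card := Finset.card_pos.mpr ⟨v, hv⟩
  obtain ⟨U, hUT, hUc, hU⟩ := key (T.card - 1) (by omega)
  rwa [Finset.eq_of_subset_of_card_le hUT (by omega)] at hU

theorem nonempty_of_connected_induce {V : Type*} {G : SimpleGraph V} {T : Finset V}
    (hT : (G.induce (T : Set V)).Connected) : T.Nonempty := by
  obtain ⟨⟨v, hv⟩⟩ := hT.nonempty
  exact ⟨v, hv⟩

/-- Connected sets in a graph of maximum degree at most one have at most two vertices. -/
theorem card_le_two_of_connected {V : Type*} [Fintype V] [DecidableEq V]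
    {G : SimpleGraph V}
    (hD : ∀ v, (G.neighborSet v).ncard ≤ 1) {T : Finset V}
    (hT : (G.induce (T : Set V)).Connected) : T.card ≤ 2 := by
  classical
  obtain ⟨v, hv⟩ := nonempty_of_connected_induce hT
  -- No edge leaves the closed neighbourhood of `v`: a neighbour of `v` already spends its only edge
  -- on `v`.
  have hsub : T ⊆ insert v (G.neighborSet v).toFinset := by
    intro x hx
    by_contra hxU
    obtain ⟨u, huU, -, w, -, hwU, huw⟩ :=
      exists_adj_of_connected_induce hT (Finset.mem_insert_self v _) hv hx hxU
    simp only [Finset.mem_insert, Set.mem_toFinset, SimpleGraph.mem_neighborSet, not_or]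
      at huU hwU
    rcases huU with rfl | huU
    · exact hwU.2 huw
    · exact hwU.1 ((Set.ncard_le_one (Set.toFinite _)).mp (hD u) w huw v huU.symm)
  refine (Finset.card_le_card hsub).trans ((Finset.card_insert_le _ _).trans ?_)
  rw [← Set.ncard_eq_toFinset_card']
  exact Nat.succ_le_succ (hD v)

/-! ### Maximal connected `α`-subsets -/

theorem connected_induce_insert {V : Type*} [DecidableEq V] {G : SimpleGraph V} {T : Finset V}
    (hT : (G.induce (T : Set V)).Connected) {u w : V} (hu : u ∈ T) (huw : G.Adj u w) :
    (G.induce ((insert w T : Finset V) : Set V)).Connected := by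
  have h : ((insert w T : Finset V) : Set V) = (T : Set V) ∪ {u, w} := by
    ext x
    simp only [Finset.coe_insert, Set.mem_insert_iff, SetLike.mem_coe, Set.mem_union,
      Set.mem_singleton_iff]
    grind
  rw [h]
  exact SimpleGraph.induce_union_connected hT.preconnected
    (SimpleGraph.induce_pair_connected_of_adj huw).preconnected ⟨u, hu, by simp⟩

/-- A maximal connected `α`-subset `T` of `X` has no neighbours in `X \ T`. -/
theorem exists_isolated_alphaSubset {V : Type*} [Fintype V] [DecidableEq V]
    {G : SimpleGraph V} {α : ℝ} {X : Finset V}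
    {L : ℝ} (hL : 0 ≤ L) (h : L < (maxconn G α X : ℝ)) :
    ∃ T : Finset V, (G.induce (T : Set V)).Connected ∧ IsAlphaSubset α X T ∧
      L < (T.card : ℝ) ∧ α ≤ 1 ∧ ∀ u ∈ T, ∀ w ∈ X, w ∉ T → ¬ G.Adj u w := by
  classical
  have hpos : 0 < maxconn G α X := by exact_mod_cast hL.trans_lt h
  have hne : (Finset.univ.filter fun T : Finset V =>
      (G.induce (T : Set V)).Connected ∧ IsAlphaSubset α X T).Nonempty := by
    by_contra hcon
    rw [Finset.not_nonempty_iff_eq_empty] at hcon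
    unfold maxconn at hpos
    rw [hcon] at hpos
    simp at hpos
  obtain ⟨T, hTmem, hTmax⟩ := Finset.exists_mem_eq_sup _ hne Finset.card
  have hTcard : maxconn G α X = T.card := hTmax
  simp only [Finset.mem_filter, Finset.mem_univ, true_and] at hTmem
  have hα : α ≤ 1 := by
    have h1 : α * (T.card : ℝ) ≤ ((T ∩ X).card : ℝ) := hTmem.2
    have h2 : ((T ∩ X).card : ℝ) ≤ (T.card : ℝ) :=
      Nat.cast_le.mpr (Finset.card_le_card Finset.inter_subset_left)
    have h3 : (0 : ℝ) < T.card := by rw [← hTcard]; exact_mod_cast hpos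
    by_contra! hα
    nlinarith
  refine ⟨T, hTmem.1, hTmem.2, by rwa [← hTcard], hα, ?_⟩
  intro u hu w hwX hwT huw
  -- Adding `w ∈ X` raises both `|T|` and `|T ∩ X|` by one, which preserves the inequality because
  -- `α ≤ 1`.
  have hins : IsAlphaSubset α X (insert w T) := by
    have h1 : α * (T.card : ℝ) ≤ ((T ∩ X).card : ℝ) := hTmem.2
    unfold IsAlphaSubset
    rw [Finset.insert_inter_of_mem hwX, Finset.card_insert_of_notMem hwT,
      Finset.card_insert_of_notMem (by simp [hwT])]
    push_cast
    linarith
  have hle : (insert w T).card ≤ maxconn G α X :=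
    Finset.le_sup (f := Finset.card) (by
      simp only [Finset.mem_filter, Finset.mem_univ, true_and]
      exact ⟨connected_induce_insert hTmem.1 hu huw, hins⟩)
  rw [Finset.card_insert_of_notMem hwT, hTcard] at hle
  omega


/-! ### Restricted errors, minimal weight and local testability -/

/-- The restriction of a Pauli word to a set of qubits. -/
def restrictTo {n : ℕ} (T : Finset (Fin n)) (E : PauliWord n) : PauliWord n :=
  fun i => if i ∈ T then E i else 0

theorem restrictTo_add_compl {n : ℕ} (T : Finset (Fin n)) (E : PauliWord n) :
    restrictTo T E + restrictTo Tᶜ E = E := by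
  ext1 i
  by_cases h : i ∈ T <;> simp [restrictTo, h]

theorem supp_restrictTo {n : ℕ} (T : Finset (Fin n)) (E : PauliWord n) :
    supp (restrictTo T E) = T ∩ supp E := by
  ext i
  simp [supp, restrictTo]

theorem wt_restrictTo_add_compl {n : ℕ} (T : Finset (Fin n)) (E : PauliWord n) :
    wt (restrictTo T E) + wt (restrictTo Tᶜ E) = wt E := by
  rw [wt, wt, wt, supp_restrictTo, supp_restrictTo, Finset.inter_comm T, Finset.inter_comm Tᶜ,
    ← Finset.sdiff_eq_inter_compl, Finset.card_inter_add_card_sdiff]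

theorem wt_add_le {n : ℕ} (E F : PauliWord n) : wt (E + F) ≤ wt E + wt F := by
  refine (Finset.card_le_card ?_).trans (Finset.card_union_le _ _)
  intro i
  simp only [supp, Finset.mem_filter, Finset.mem_univ, true_and, Finset.mem_union, Pi.add_apply]
  contrapose!
  rintro ⟨h1, h2⟩
  rw [h1, h2, add_zero]

theorem isMinimalError_iff {n : ℕ} (S : Finset (SignedPauli n)) (E : PauliWord n) :
    IsMinimalError S E ↔ ∀ z ∈ centralizer S, wt E ≤ wt (E + z) := by
  have h0 : (0 : PauliWord n) ∈ centralizer S := by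
    rw [mem_centralizer_iff]
    intro g _
    exact wordSign_eq_one_of_disjoint (by simp [supp])
  have hle : wtMod S E ≤ wt E := Nat.sInf_le ⟨0, h0, by simp⟩
  constructor
  · intro h z hz
    rw [IsMinimalError] at h
    rw [h]
    exact Nat.sInf_le ⟨z, hz, rfl⟩
  · intro h
    refine le_antisymm ?_ hle
    refine le_csInf ⟨_, 0, h0, rfl⟩ ?_
    rintro _ ⟨z, hz, rfl⟩
    exact h z hz

/-- A lighter representative of the restriction, combined with the untouched part of `E`, would be a
lighter representative of `E`. -/
theorem IsMinimalError.restrictTo {n : ℕ} {S : Finset (SignedPauli n)} {E : PauliWord n}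
    (hE : IsMinimalError S E) (T : Finset (Fin n)) :
    IsMinimalError S (ThermalLTC.restrictTo T E) := by
  rw [isMinimalError_iff] at hE ⊢
  intro z hz
  have h1 := hE z hz
  have h2 : E + z = (ThermalLTC.restrictTo T E + z) + ThermalLTC.restrictTo Tᶜ E := by
    nth_rewrite 1 [← restrictTo_add_compl T E]
    abel
  rw [h2, ← wt_restrictTo_add_compl T E] at h1
  have h3 := wt_add_le (ThermalLTC.restrictTo T E + z) (ThermalLTC.restrictTo Tᶜ E)
  omega

theorem IsSLTC.wtMod_div_mul_le {n : ℕ} {S : Finset (SignedPauli n)} {q : ℕ} {s : ℝ}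
    (h : IsSLTC S q s) (P : PauliWord n) :
    ((wtMod S P : ℝ) / n) * s ≤ ((syndrome S P).card : ℝ) / S.card := by
  refine (h.2.2 P).trans_eq ?_
  congr 3
  ext g
  simp only [syndrome, Finset.mem_filter, commute_signedOp_wordOp_iff, ne_eq]

theorem IsSLTC.mul_wt_le {n : ℕ} {S : Finset (SignedPauli n)} {q : ℕ} {s : ℝ}
    (h : IsSLTC S q s) {P : PauliWord n} (hP : IsMinimalError S P) :
    s * energyDensity S * wt P ≤ (syndrome S P).card := by
  have h1 := h.wtMod_div_mul_le P
  rw [← hP] at h1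
  rw [energyDensity]
  rcases S.card.eq_zero_or_pos with h0 | hpos
  · simp [h0]
  · have hm : (0 : ℝ) < S.card := Nat.cast_pos.mpr hpos
    rw [le_div_iff₀ hm] at h1
    calc s * ((S.card : ℝ) / n) * wt P = ((wt P : ℝ) / n) * s * S.card := by ring
      _ ≤ _ := h1

theorem IsSLTC.energyDensity_pos {n : ℕ} {S : Finset (SignedPauli n)} {q : ℕ} {s : ℝ}
    (h : IsSLTC S q s) (hs : 0 < s) (hn : 0 < n) {P : PauliWord n} (hP : IsMinimalError S P)
    (hwt : 0 < wt P) : 0 < energyDensity S := by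
  have h1 := h.wtMod_div_mul_le P
  rw [← hP] at h1
  have hn' : (0 : ℝ) < n := Nat.cast_pos.mpr hn
  rcases S.card.eq_zero_or_pos with h0 | hpos
  -- With no checks the violated fraction is `0 / 0 = 0`, which contradicts soundness for a word of
  -- positive weight.
  · rw [h0, Nat.cast_zero, div_zero] at h1
    have : (0 : ℝ) < ((wt P : ℝ) / n) * s := by positivity
    linarith
  · exact div_pos (Nat.cast_pos.mpr hpos) hn'

theorem syndrome_add {n : ℕ} (S : Finset (SignedPauli n)) (E F : PauliWord n) :
    syndrome S (E + F) = symmDiff (syndrome S E) (syndrome S F) := by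
  ext g
  simp only [syndrome, Finset.mem_symmDiff, Finset.mem_filter, wordSign_add]
  rcases Int.units_eq_one_or (wordSign g.2 E) with hE | hE <;>
  rcases Int.units_eq_one_or (wordSign g.2 F) with hF | hF <;> simp [hE, hF]

theorem exists_mem_supp_of_mem_syndrome {n : ℕ} {S : Finset (SignedPauli n)} {E : PauliWord n}
    {g : SignedPauli n} (hg : g ∈ syndrome S E) : ∃ i ∈ supp g.2, i ∈ supp E := by
  by_contra! h
  exact (Finset.mem_filter.mp hg).2
    (wordSign_eq_one_of_disjoint (Finset.disjoint_left.mpr fun i hi => h i hi))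

/-- A check violated by both parts meets the support inside `T` and outside `T`, which would make
two such qubits adjacent. -/
theorem disjoint_syndrome_restrictTo {n : ℕ} {S : Finset (SignedPauli n)} {E : PauliWord n}
    {T : Finset (Fin n)}
    (hT : ∀ u ∈ T, ∀ w ∈ supp E, w ∉ T → ¬ (interactionGraph S).Adj u w) :
    Disjoint (syndrome S (restrictTo Tᶜ E)) (syndrome S (restrictTo T E)) := by
  refine Finset.disjoint_left.mpr fun g h1 h2 => ?_
  obtain ⟨w, hwg, hw⟩ := exists_mem_supp_of_mem_syndrome h1
  obtain ⟨u, hug, hu⟩ := exists_mem_supp_of_mem_syndrome h2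
  rw [supp_restrictTo, Finset.mem_inter] at hw hu
  have hwT : w ∉ T := by simpa using hw.1
  exact hT u hu.1 w hw.2 hwT
    ⟨fun h => hwT (h ▸ hu.1), g, (Finset.mem_filter.mp h1).1, hug, hwg⟩

/-! ### Few checks at a qubit when the degree is small -/

open Classical in
theorem card_words_supp_subset_le {n : ℕ} (T : Finset (Fin n)) :
    (Finset.univ.filter fun F : PauliWord n => supp F ⊆ T).card ≤ 4 ^ T.card := by
  have h : Fintype.card (T → Pauli) = 4 ^ T.card := by simp
  rw [← h, ← Finset.card_univ]
  refine Finset.card_le_card_of_injOn (fun F i => F i) (fun _ _ => Finset.mem_coe.mpr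
    (Finset.mem_univ _)) ?_
  intro F hF G hG hFG
  simp only [Finset.coe_filter, Finset.mem_univ, true_and, Set.mem_ofPred_eq] at hF hG
  ext1 i
  by_cases hi : i ∈ T
  · exact congrFun hFG ⟨i, hi⟩
  · have h1 : F i = 0 := by
      by_contra h0
      exact hi (hF (by simp [supp, h0]))
    have h2 : G i = 0 := by
      by_contra h0
      exact hi (hG (by simp [supp, h0]))
    rw [h1, h2]

/-- The number of distinct checks acting on one qubit is bounded in terms of the degree. -/
theorem card_checks_at_le {n : ℕ} {S : Finset (SignedPauli n)} {D : ℕ}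
    (hD : ∀ v : Fin n, ((interactionGraph S).neighborSet v).ncard ≤ D) (v : Fin n) :
    (S.filter fun g => v ∈ supp g.2).card ≤ 2 * 4 ^ (D + 1) := by
  classical
  set N : Finset (Fin n) := insert v ((interactionGraph S).neighborSet v).toFinset with hN
  have hNc : N.card ≤ D + 1 := by
    refine (Finset.card_insert_le _ _).trans ?_
    rw [← Set.ncard_eq_toFinset_card']
    exact Nat.succ_le_succ (hD v)
  -- Every check at `v` is a signed word on the closed neighbourhood of `v`. Since `S` has no
  -- repetitions, counting such words bounds the checks.
  have hsub : (S.filter fun g => v ∈ supp g.2) ⊆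
      (Finset.univ : Finset ℤˣ) ×ˢ (Finset.univ.filter fun F : PauliWord n => supp F ⊆ N) := by
    intro g hg
    obtain ⟨hgS, hgv⟩ := Finset.mem_filter.mp hg
    simp only [Finset.mem_product, Finset.mem_univ, Finset.mem_filter, true_and]
    intro i hi
    rw [hN, Finset.mem_insert, Set.mem_toFinset]
    by_cases hiv : i = v
    · exact Or.inl hiv
    · exact Or.inr ⟨Ne.symm hiv, g, hgS, hgv, hi⟩
  refine (Finset.card_le_card hsub).trans ?_
  rw [Finset.card_product]
  have h2 : (Finset.univ : Finset ℤˣ).card = 2 := by decide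
  rw [h2]
  exact Nat.mul_le_mul_left _
    ((card_words_supp_subset_le N).trans (Nat.pow_le_pow_right (by norm_num) hNc))

/-- A code with a nontrivial error class needs many distinct checks per qubit, hence a large
degree. -/
theorem IsSLTC.mul_energyDensity_le {n : ℕ} {S : Finset (SignedPauli n)} {q D : ℕ} {s : ℝ}
    (h : IsSLTC S q s) (hD : ∀ v : Fin n, ((interactionGraph S).neighborSet v).ncard ≤ D)
    {E : PauliWord n} (hE : IsMinimalError S E) (hwt : 0 < wt E) :
    s * energyDensity S ≤ 2 * 4 ^ (D + 1) := by
  obtain ⟨v, hv⟩ := Finset.card_pos.mp hwt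
  -- A one-qubit piece of `E` is again minimal, so soundness forces at least `s λ` violated checks,
  -- all acting on `v`.
  have h1 := h.mul_wt_le (hE.restrictTo {v})
  have hsupp : supp (restrictTo {v} E) = {v} := by
    rw [supp_restrictTo, Finset.singleton_inter_of_mem hv]
  have hw : wt (restrictTo {v} E) = 1 := by rw [wt, hsupp, Finset.card_singleton]
  have hsub : syndrome S (restrictTo {v} E) ⊆ S.filter fun g => v ∈ supp g.2 := by
    intro g hg
    obtain ⟨i, hi, hi'⟩ := exists_mem_supp_of_mem_syndrome hg
    rw [hsupp, Finset.mem_singleton] at hi'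
    exact Finset.mem_filter.mpr ⟨(Finset.mem_filter.mp hg).1, hi' ▸ hi⟩
  have h2 := (Finset.card_le_card hsub).trans (card_checks_at_le hD v)
  rw [hw, Nat.cast_one, mul_one] at h1
  exact h1.trans (by exact_mod_cast h2)

/-! ### The union bound -/

/-- Union bound over syndrome shifts. -/
theorem sum_syndromeProb_le_of_shift {n : ℕ} {S : Finset (SignedPauli n)}
    {μ : PMF (PauliWord n)} {ι : Type*} (C : Finset (Finset (SignedPauli n))) (I : Finset ι)
    (σ : ι → Finset (SignedPauli n)) (ρ : ι → ℝ) (hρ : ∀ i ∈ I, 0 ≤ ρ i)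
    (h : ∀ c ∈ C, ∃ i ∈ I, syndromeProb S μ c ≤ ρ i * syndromeProb S μ (symmDiff c (σ i))) :
    ∑ c ∈ C, syndromeProb S μ c ≤ ∑ i ∈ I, ρ i := by
  calc ∑ c ∈ C, syndromeProb S μ c
      ≤ ∑ c ∈ C, ∑ i ∈ I, ρ i * syndromeProb S μ (symmDiff c (σ i)) := by
        refine Finset.sum_le_sum fun c hc => ?_
        obtain ⟨i, hi, hle⟩ := h c hc
        exact hle.trans (Finset.single_le_sum
          (f := fun i => ρ i * syndromeProb S μ (symmDiff c (σ i)))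
          (fun j hj => mul_nonneg (hρ j hj) (syndromeProb_nonneg _ _ _)) hi)
    _ = ∑ i ∈ I, ρ i * ∑ c ∈ C, syndromeProb S μ (symmDiff c (σ i)) := by
        rw [Finset.sum_comm]
        simp only [Finset.mul_sum]
    _ ≤ ∑ i ∈ I, ρ i := by
        refine Finset.sum_le_sum fun i hi => mul_le_of_le_one_right (hρ i hi) ?_
        -- Symmetric difference with a fixed set is injective, so the shifted syndromes are distinct
        -- and their probabilities sum to at most one.
        rw [← Finset.sum_image (s := C) (g := fun c => symmDiff c (σ i))
          (f := syndromeProb S μ) (fun a _ b _ hab => symmDiff_left_injective (σ i) hab)]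
        exact sum_syndromeProb_le_one S μ _

theorem sum_toReal_le_sum_syndromeProb {n : ℕ} (S : Finset (SignedPauli n))
    (μ : PMF (PauliWord n)) (B : Finset (PauliWord n)) :
    ∑ E ∈ B, (μ E).toReal ≤ ∑ c ∈ B.image (syndrome S), syndromeProb S μ c := by
  simp only [syndromeProb]
  rw [Finset.sum_comm]
  simp only [Finset.sum_ite_eq]
  rw [← Finset.sum_filter]
  refine Finset.sum_le_sum_of_subset_of_nonneg ?_ fun _ _ _ => ENNReal.toReal_nonneg
  intro E hE
  exact Finset.mem_filter.mpr ⟨Finset.mem_univ _, Finset.mem_image_of_mem _ hE⟩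

theorem sum_biUnion_le_sum_sum {ι κ : Type*} [DecidableEq κ] (J : Finset ι)
    (W : ι → Finset κ) (f : κ → ℝ) (hf : ∀ k, 0 ≤ f k) :
    ∑ k ∈ J.biUnion W, f k ≤ ∑ j ∈ J, ∑ k ∈ W j, f k := by
  classical
  induction J using Finset.induction_on with
  | empty => simp
  | insert j J hj ih =>
    rw [Finset.biUnion_insert, Finset.sum_insert hj]
    have h := Finset.sum_union_inter (s₁ := W j) (s₂ := J.biUnion W) (f := f)
    have h0 : 0 ≤ ∑ k ∈ W j ∩ J.biUnion W, f k := Finset.sum_nonneg fun k _ => hf k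
    linarith

open Classical in
/-- Weighted count of the connected sets with more than `L` vertices. -/
theorem sum_connected_pow_le {V : Type*} [Fintype V] [DecidableEq V] {G : SimpleGraph V} {D : ℕ}
    (hD : ∀ v, (G.neighborSet v).ncard ≤ D) (hD1 : 1 ≤ D) {x y L : ℝ} (hx : 0 ≤ x)
    (hy : ∀ t : ℕ, L < t → ((D : ℝ) ^ 2 * x) ^ t ≤ y) (hy0 : 0 ≤ y) :
    ∑ T ∈ Finset.univ.filter fun T : Finset V =>
        (G.induce (T : Set V)).Connected ∧ L < (T.card : ℝ), x ^ T.card ≤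
      (Fintype.card V : ℝ) ^ 2 * y := by
  -- Connected sets are grouped by a base vertex and by their size; these `|V|²` pairs give the
  -- prefactor.
  set J : Finset (V × ℕ) := Finset.univ ×ˢ Finset.Icc 1 (Fintype.card V) with hJ
  set W : V × ℕ → Finset (Finset V) := fun p =>
    (walkRanges G (2 * (p.2 - 1)) p.1).filter fun T => T.card = p.2 ∧ L < (T.card : ℝ) with hW
  calc ∑ T ∈ Finset.univ.filter fun T : Finset V =>
        (G.induce (T : Set V)).Connected ∧ L < (T.card : ℝ), x ^ T.card
      ≤ ∑ T ∈ J.biUnion W, x ^ T.card := by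
        refine Finset.sum_le_sum_of_subset_of_nonneg ?_ fun _ _ _ => pow_nonneg hx _
        intro T hT
        obtain ⟨-, hTc, hTL⟩ := Finset.mem_filter.mp hT
        obtain ⟨v, hv⟩ := nonempty_of_connected_induce hTc
        refine Finset.mem_biUnion.mpr ⟨(v, T.card), ?_, ?_⟩
        · simp only [hJ, Finset.mem_product, Finset.mem_univ, true_and, Finset.mem_Icc]
          exact ⟨Finset.card_pos.mpr ⟨v, hv⟩, Finset.card_le_univ T⟩
        · exact Finset.mem_filter.mpr ⟨mem_walkRanges_of_connected hTc hv, rfl, hTL⟩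
    _ ≤ ∑ p ∈ J, ∑ T ∈ W p, x ^ T.card :=
        sum_biUnion_le_sum_sum _ _ _ fun _ => pow_nonneg hx _
    _ ≤ ∑ p ∈ J, y := by
        refine Finset.sum_le_sum fun p hp => ?_
        rcases (W p).eq_empty_or_nonempty with h0 | ⟨T, hT⟩
        · rw [h0, Finset.sum_empty]; exact hy0
        · have hpL : L < (p.2 : ℝ) := by
            obtain ⟨-, h1, h2⟩ := Finset.mem_filter.mp hT
            rwa [h1] at h2
          have hD1' : (1 : ℝ) ≤ D := by exact_mod_cast hD1
          have hc : ((W p).card : ℝ) ≤ (D : ℝ) ^ (2 * p.2) := by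
            have h1 : (W p).card ≤ D ^ (2 * (p.2 - 1)) := (Finset.card_filter_le _ _).trans
              (card_walkRanges_le hD (2 * (p.2 - 1)) p.1)
            calc ((W p).card : ℝ) ≤ (D : ℝ) ^ (2 * (p.2 - 1)) := by exact_mod_cast h1
              _ ≤ _ := pow_le_pow_right₀ hD1' (by omega)
          calc ∑ T ∈ W p, x ^ T.card = ∑ T ∈ W p, x ^ p.2 :=
                Finset.sum_congr rfl fun T hT => by rw [(Finset.mem_filter.mp hT).2.1]
            _ = (W p).card * x ^ p.2 := by rw [Finset.sum_const, nsmul_eq_mul]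
            _ ≤ (D : ℝ) ^ (2 * p.2) * x ^ p.2 :=
                mul_le_mul_of_nonneg_right hc (pow_nonneg hx _)
            _ = ((D : ℝ) ^ 2 * x) ^ p.2 := by rw [mul_pow, pow_mul]
            _ ≤ y := hy _ hpL
    _ = (Fintype.card V : ℝ) ^ 2 * y := by
        rw [Finset.sum_const, hJ, Finset.card_product, Finset.card_univ, Nat.card_Icc,
          nsmul_eq_mul]
        push_cast
        ring

theorem wt_pos_of_lt_maxconn {n : ℕ} {G : SimpleGraph (Fin n)} {α L : ℝ} {E : PauliWord n}
    (hα : 0 < α) (hL : 0 ≤ L) (h : L < (maxconn G α (supp E) : ℝ)) : 0 < wt E := by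
  obtain ⟨T, -, hT, hTL, -⟩ := exists_isolated_alphaSubset hL h
  have h1 : α * (T.card : ℝ) ≤ ((T ∩ supp E).card : ℝ) := hT
  have h2 : (0 : ℝ) < (T ∩ supp E).card := (mul_pos hα (hL.trans_lt hTL)).trans_le h1
  exact (Nat.cast_pos.mp h2).trans_le (Finset.card_le_card Finset.inter_subset_right)

/-- Removing an isolated connected `α`-subset from an error costs a factor `D ^ (-10 |T|)`. -/
theorem syndromeProb_le_of_isolated {n : ℕ} {S : Finset (SignedPauli n)} {q D : ℕ}
    {s α β : ℝ} {μ : PMF (PauliWord n)} (hn : 0 < n) (hs : 0 < s) (hS : IsSLTC S q s)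
    (hα : 0 < α) (hD : 1 ≤ D) (hβ : (10 / α) * Real.log D / s ≤ β)
    (hμ : IsGibbsErrorLaw S β μ) {E : PauliWord n} (hE : IsMinimalError S E)
    {T : Finset (Fin n)} (hT0 : 0 < T.card) (hTα : IsAlphaSubset α (supp E) T)
    (hT : ∀ u ∈ T, ∀ w ∈ supp E, w ∉ T → ¬ (interactionGraph S).Adj u w) :
    syndromeProb S μ (syndrome S E) ≤ (1 / (D : ℝ) ^ 10) ^ T.card *
      syndromeProb S μ (symmDiff (syndrome S E) (syndrome S (restrictTo T E))) := by
  have hsyn : syndrome S E =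
      symmDiff (syndrome S (restrictTo Tᶜ E)) (syndrome S (restrictTo T E)) := by
    rw [← syndrome_add, add_comm, restrictTo_add_compl]
  have hsyn' : symmDiff (syndrome S E) (syndrome S (restrictTo T E)) =
      syndrome S (restrictTo Tᶜ E) := by
    rw [hsyn, symmDiff_symmDiff_cancel_right]
  have hcard : (syndrome S E).card = (syndrome S (restrictTo Tᶜ E)).card +
      (syndrome S (restrictTo T E)).card := by
    have hd := disjoint_syndrome_restrictTo hT
    rw [hsyn, hd.symmDiff_eq_sup, Finset.sup_eq_union, Finset.card_union_of_disjoint hd]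
  rw [hsyn', syndromeProb_eq_exp_mul hS.1.2 hμ E (restrictTo Tᶜ E) hcard]
  refine mul_le_mul_of_nonneg_right ?_ (syndromeProb_nonneg _ _ _)
  have hF := hE.restrictTo T
  have hwt : α * T.card ≤ wt (restrictTo T E) := by
    rw [wt, supp_restrictTo]
    exact hTα
  have hT0' : (0 : ℝ) < T.card := Nat.cast_pos.mpr hT0
  have hwt0 : 0 < wt (restrictTo T E) := Nat.cast_pos.mp ((mul_pos hα hT0').trans_le hwt)
  have hlam := hS.energyDensity_pos hs hn hF hwt0
  have hk := hS.mul_wt_le hF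
  have hlog : 0 ≤ Real.log D := Real.log_nonneg (by exact_mod_cast hD)
  have hβ0 : 0 ≤ β := le_trans (by positivity) hβ
  have hD0 : (0 : ℝ) < D := by exact_mod_cast hD
  have h10 : 10 * Real.log D ≤ β * s * α := by
    rw [div_le_iff₀ hs, div_mul_eq_mul_div, div_le_iff₀ hα] at hβ
    exact hβ
  -- The energy removed is at least `s λ α |T|`; the factor `λ` cancels in the exponent and `β s α ≥
  -- 10 ln D` remains.
  have hmain : 10 * Real.log D * T.card ≤
      β / energyDensity S * (syndrome S (restrictTo T E)).card := by
    calc 10 * Real.log D * T.card ≤ β * s * α * T.card := by gcongr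
      _ = β * s * (α * T.card) := by ring
      _ ≤ β * s * wt (restrictTo T E) := by gcongr
      _ = β / energyDensity S * (s * energyDensity S * wt (restrictTo T E)) := by
          field_simp
      _ ≤ _ := by gcongr
  calc Real.exp (-(β / energyDensity S) * (syndrome S (restrictTo T E)).card)
      ≤ Real.exp (-(10 * Real.log D * T.card)) := Real.exp_le_exp.mpr (by linarith)
    _ = (1 / (D : ℝ) ^ 10) ^ T.card := by
        have h : 10 * Real.log D * T.card = ((10 * T.card : ℕ) : ℝ) * Real.log D := by
          push_cast; ring
        rw [h, Real.exp_neg, Real.exp_nat_mul, Real.exp_log hD0, one_div, inv_pow, ← pow_mul]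

/-- The factors per vertex are `D²` for walks, `4` for Pauli letters and `D^{-10}` for the Boltzmann
weight. The estimate uses `e² ≤ 2³`, so that `4 e^{500} ≤ 2^{800} ≤ D^8`. -/
theorem sq_mul_four_div_pow_le_exp {D : ℕ} (hD : (2 : ℝ) ^ 100 ≤ D) :
    (D : ℝ) ^ 2 * (4 * (1 / (D : ℝ) ^ 10)) ≤ Real.exp (-500) := by
  have hD0 : (0 : ℝ) < D := lt_of_lt_of_le (by positivity) hD
  have h1 : (D : ℝ) ^ 2 * (4 * (1 / (D : ℝ) ^ 10)) = 4 / (D : ℝ) ^ 8 := by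
    field_simp
  have h2 : Real.exp 500 ≤ (2 : ℝ) ^ 798 := by
    have he : Real.exp 1 ^ 2 ≤ 2 ^ 3 := by
      have := Real.exp_one_lt_d9
      have h0 := Real.exp_pos 1
      nlinarith
    calc Real.exp 500 = (Real.exp 1 ^ 2) ^ 250 := by
          rw [← pow_mul, ← Real.exp_nat_mul]; norm_num
      _ ≤ ((2 : ℝ) ^ 3) ^ 250 := by gcongr
      _ = 2 ^ 750 := by rw [← pow_mul]
      _ ≤ 2 ^ 798 := pow_le_pow_right₀ (by norm_num) (by norm_num)
  rw [h1, Real.exp_neg, div_le_iff₀ (by positivity), inv_mul_eq_div, le_div_iff₀ (Real.exp_pos _)]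
  calc 4 * Real.exp 500 ≤ 2 ^ 2 * 2 ^ 798 := by
        have : (4 : ℝ) = 2 ^ 2 := by norm_num
        rw [this]; gcongr
    _ = ((2 : ℝ) ^ 100) ^ 8 := by rw [← pow_add, ← pow_mul]
    _ ≤ (D : ℝ) ^ 8 := by gcongr

/-- The tail bound for codes of large degree. -/
theorem sum_le_of_lt_maxconn {n : ℕ} {S : Finset (SignedPauli n)} {q D : ℕ}
    {s α β : ℝ} {μ : PMF (PauliWord n)} (hn : 0 < n) (hs : 0 < s) (hS : IsSLTC S q s)
    (hdeg : ∀ v : Fin n, ((interactionGraph S).neighborSet v).ncard ≤ D)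
    (hα : 0 < α) (hD : (2 : ℝ) ^ 100 ≤ D) (hβ : (10 / α) * Real.log D / s ≤ β)
    (hμ : IsGibbsErrorLaw S β μ) (B : Finset (PauliWord n))
    (hB : ∀ E ∈ B, IsMinimalError S E ∧
      Real.log n / 100 < (maxconn (interactionGraph S) α (supp E) : ℝ)) :
    ∑ E ∈ B, (μ E).toReal ≤ (n : ℝ) ^ (-3 : ℤ) := by
  classical
  have hD1 : 1 ≤ D := by
    have : (1 : ℝ) ≤ D := le_trans (by norm_num) hD
    exact_mod_cast this
  have hn1 : (1 : ℝ) ≤ n := by exact_mod_cast hn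
  have hn0 : (0 : ℝ) < n := by linarith
  have hL : 0 ≤ Real.log n / 100 := div_nonneg (Real.log_nonneg hn1) (by norm_num)
  set I : Finset (Finset (Fin n)) := Finset.univ.filter fun T : Finset (Fin n) =>
    ((interactionGraph S).induce (T : Set (Fin n))).Connected ∧ Real.log n / 100 < (T.card : ℝ)
    with hI
  set words : Finset (Fin n) → Finset (PauliWord n) := fun T =>
    Finset.univ.filter fun F : PauliWord n => supp F ⊆ T with hwords
  calc ∑ E ∈ B, (μ E).toReal ≤ ∑ c ∈ B.image (syndrome S), syndromeProb S μ c :=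
        sum_toReal_le_sum_syndromeProb S μ B
    _ ≤ ∑ p ∈ I.sigma words, (1 / (D : ℝ) ^ 10) ^ p.1.card := by
        refine sum_syndromeProb_le_of_shift _ _ (fun p => syndrome S p.2) _
          (fun _ _ => by positivity) ?_
        intro c hc
        obtain ⟨E, hEB, rfl⟩ := Finset.mem_image.mp hc
        obtain ⟨hmin, hE⟩ := hB E hEB
        obtain ⟨T, hTc, hTα, hTL, -, hT⟩ := exists_isolated_alphaSubset hL hE
        refine ⟨⟨T, restrictTo T E⟩, ?_, ?_⟩
        · refine Finset.mem_sigma.mpr ⟨Finset.mem_filter.mpr ⟨Finset.mem_univ _, hTc, hTL⟩,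
            Finset.mem_filter.mpr ⟨Finset.mem_univ _, ?_⟩⟩
          rw [supp_restrictTo]
          exact Finset.inter_subset_left
        · exact syndromeProb_le_of_isolated hn hs hS hα hD1 hβ hμ hmin
            (Finset.card_pos.mpr (nonempty_of_connected_induce hTc)) hTα hT
    _ = ∑ T ∈ I, (words T).card * (1 / (D : ℝ) ^ 10) ^ T.card := by
        rw [Finset.sum_sigma]
        simp only [Finset.sum_const, nsmul_eq_mul]
    _ ≤ ∑ T ∈ I, (4 * (1 / (D : ℝ) ^ 10)) ^ T.card := by
        refine Finset.sum_le_sum fun T _ => ?_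
        rw [mul_pow]
        refine mul_le_mul_of_nonneg_right ?_ (by positivity)
        exact_mod_cast card_words_supp_subset_le T
    _ ≤ (Fintype.card (Fin n) : ℝ) ^ 2 * (n : ℝ) ^ (-5 : ℤ) := by
        refine sum_connected_pow_le hdeg hD1 (by positivity) ?_ (by positivity)
        intro t ht
        calc ((D : ℝ) ^ 2 * (4 * (1 / (D : ℝ) ^ 10))) ^ t ≤ Real.exp (-500) ^ t :=
              pow_le_pow_left₀ (by positivity) (sq_mul_four_div_pow_le_exp hD) t
          _ = Real.exp (t * (-500)) := by rw [Real.exp_nat_mul]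
          -- Since `t > ln n / 100`, the exponent `500 t` exceeds `5 ln n`; two of the five powers
          -- of `n` are spent on the prefactor `n²`.
          _ ≤ Real.exp (-(5 * Real.log n)) := Real.exp_le_exp.mpr (by linarith)
          _ = (n : ℝ) ^ (-5 : ℤ) := by
              rw [Real.exp_neg, zpow_neg]
              congr 1
              have : (5 : ℝ) = ((5 : ℕ) : ℝ) := by norm_num
              rw [this, Real.exp_nat_mul, Real.exp_log hn0]
              norm_cast
    _ = (n : ℝ) ^ (-3 : ℤ) := by
        rw [Fintype.card_fin, ← zpow_natCast, ← zpow_add₀ hn0.ne']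
        norm_num

theorem toOuterMeasure_le_of_sum_le {n : ℕ} {μ : PMF (PauliWord n)} {A : Set (PauliWord n)}
    {b : ℝ} (h : ∀ B : Finset (PauliWord n), (∀ E ∈ B, E ∈ A ∧ E ∈ μ.support) →
      ∑ E ∈ B, (μ E).toReal ≤ b) : μ.toOuterMeasure A ≤ ENNReal.ofReal b := by
  classical
  rw [← μ.toOuterMeasure_apply_inter_support, PMF.toOuterMeasure_apply_fintype]
  have h1 := h (Finset.univ.filter fun E => E ∈ A ∩ μ.support)
    fun E hE => (Finset.mem_filter.mp hE).2
  refine le_trans (le_of_eq ?_) (ENNReal.ofReal_le_ofReal h1)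
  rw [ENNReal.ofReal_sum_of_nonneg fun _ _ => ENNReal.toReal_nonneg, Finset.sum_filter]
  refine Finset.sum_congr rfl fun E _ => ?_
  rw [Set.indicator_apply]
  split_ifs
  · rw [ENNReal.ofReal_toReal (μ.apply_ne_top E)]
  · rfl

end ThermalLTC

/-! ### Large degree is forced, and conclusion -/

theorem mainTheorem2 :
    ∃ n₀ : ℕ, ∀ (n : ℕ), n₀ ≤ n →
      ∀ (S : Finset (ThermalLTC.SignedPauli n)) (q : ℕ) (s : ℝ) (D : ℕ) (α β : ℝ),
        0 < s →
        ThermalLTC.IsSLTC S q s →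
        (∀ v : Fin n, ((ThermalLTC.interactionGraph S).neighborSet v).ncard ≤ D) →
        0 < α →
        (10 / α) * Real.log D / s ≤ β →
        β ≤ ThermalLTC.energyDensity S / Real.log n →
        ∀ μ : PMF (ThermalLTC.PauliWord n), ThermalLTC.IsGibbsErrorLaw S β μ →
          μ.toOuterMeasure
              {E | Real.log n / 100 <
                (ThermalLTC.maxconn (ThermalLTC.interactionGraph S) α (ThermalLTC.supp E) : ℝ)} ≤
            ENNReal.ofReal ((n : ℝ) ^ (-3 : ℤ)) := by
  obtain ⟨D₀, hD₀⟩ : ∃ D₀ : ℕ, (2 : ℝ) ^ 100 ≤ D₀ := exists_nat_ge _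
  have hlim : ∀ᶠ n : ℕ in Filter.atTop,
      -- The bound `200` makes a bad connected set have more than two vertices; the other bound
      -- rules out degrees below `D₀`.
      max 200 (2 * 4 ^ (D₀ + 1)) < Real.log n :=
    (Real.tendsto_log_atTop.comp tendsto_natCast_atTop_atTop).eventually_gt_atTop _
  obtain ⟨n₀, hn₀⟩ := Filter.eventually_atTop.mp hlim
  refine ⟨n₀, fun n hn S q s D α β hs hS hdeg hα hβ hβ' μ hμ => ?_⟩
  obtain ⟨hlog, hlogD⟩ := max_lt_iff.mp (hn₀ n hn)
  have hL : 0 ≤ Real.log n / 100 := by linarith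
  have hn0 : 0 < n := by
    rcases n.eq_zero_or_pos with rfl | h
    · norm_num at hlog
    · exact h
  refine ThermalLTC.toOuterMeasure_le_of_sum_le fun B hB => ?_
  -- The lower bounds on `D` come from one bad error of positive probability; without one the sum is
  -- empty.
  rcases B.eq_empty_or_nonempty with rfl | ⟨E, hE⟩
  · rw [Finset.sum_empty]; positivity
  obtain ⟨hEbad, hEsupp⟩ := hB E hE
  obtain ⟨T, hTc, -, hTL, hα1, -⟩ := ThermalLTC.exists_isolated_alphaSubset hL hEbad
  have hD2 : 2 ≤ D := by
    by_contra! hlt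
    have h2 := ThermalLTC.card_le_two_of_connected (fun v => (hdeg v).trans (by omega)) hTc
    have h2' : (T.card : ℝ) ≤ 2 := by exact_mod_cast h2
    linarith
  have hDlarge : D₀ ≤ D := by
    by_contra! hlt
    have h1 := hS.mul_energyDensity_le hdeg (hμ.1 E hEsupp)
      (ThermalLTC.wt_pos_of_lt_maxconn hα hL hEbad)
    have h2 : (2 : ℝ) * 4 ^ (D + 1) ≤ 2 * 4 ^ (D₀ + 1) := by
      have : (4 : ℝ) ^ (D + 1) ≤ 4 ^ (D₀ + 1) := pow_le_pow_right₀ (by norm_num) (by omega)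
      linarith
    have hlogpos : 0 < Real.log n := by linarith
    have h3 : 1 ≤ 10 * Real.log D := by
      have h4 : Real.log 2 ≤ Real.log D :=
        Real.log_le_log (by norm_num) (by exact_mod_cast hD2)
      have := Real.log_two_gt_d9
      linarith
    -- The hypothesis gives `10 ln D ≤ β s α`, and `α ≤ 1` because an `α`-subset exists. Together
    -- with `h3` this yields `β s ≥ 1`, so the upper bound on `β` gives `ln n ≤ s λ`.
    have h5 : 10 * Real.log D ≤ β * s := by
      rw [div_le_iff₀ hs, div_mul_eq_mul_div, div_le_iff₀ hα] at hβ
      have hβs : 0 ≤ β * s := by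
        by_contra! hneg
        nlinarith
      nlinarith
    rw [le_div_iff₀ hlogpos] at hβ'
    have h6 : Real.log n ≤ s * ThermalLTC.energyDensity S := by
      calc Real.log n = 1 * Real.log n := (one_mul _).symm
        _ ≤ β * s * Real.log n := by gcongr; linarith
        _ = s * (β * Real.log n) := by ring
        _ ≤ _ := by gcongr
    linarith
  exact ThermalLTC.sum_le_of_lt_maxconn hn0 hs hS hdeg hα (hD₀.trans (by exact_mod_cast hDlarge)) hβ hμ B
    fun F hF => ⟨hμ.1 F (hB F hF).2, (hB F hF).1⟩
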